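/- A signed graph $\Gamma=(G,\sigma)$ is a finite simple graph $G$ together with a sign function $\sigma:E(G)\to\{1,-1\}$. Its adjacency matrix $A(\Gamma)$ has the entry $\sigma(uv)$ at $(u,v)$ if $uv\in E(G)$ and $0$ otherwise, and its index $\lambda_1(\Gamma)$ is the largest eigenvalue of $A(\Gamma)$. A cycle is negative if the product of the signs of its edges is $-1$, and $\Gamma$ is unbalanced if it contains a negative cycle. Two signed graphs are switching equivalent if one is obtained, up to isomorphism, from the other by choosing $\theta:V\to\{1,-1\}$ and multiplying the sign of every edge $uv$ by $\theta(u)\theta(v)$. For $n\ge 3$ let $\Gamma_1=C_3^-\bullet K_{n-2}$ be the signed graph of order $n$ obtained from the all-positive complete graph $K_{n-2}$ and a triangle with exactly one negative edge by identifying a vertex of $K_{n-2}$ with the vertex of the triangle that is not on its negative edge. Let $\Gamma$ be an unbalanced signed graph of order $n\ge 12$ with $\lambda_1(\Gamma)\ge\lambda_1(\Gamma_1)$. Then $\Gamma$ contains a negative cycle of length $5$, unless $\Gamma$ is switching equivalent to $\Gamma_1$. -/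

import Mathlib

/-- A signed graph `Γ = (G, σ)` on the vertex set `V`: a simple graph `G` together with a
sign function `σ : E(G) → {1, -1}`. -/
structure SignedGraph (V : Type*) where
  /-- The underlying graph. -/
  graph : SimpleGraph V
  /-- The sign of each edge. -/
  sign : graph.edgeSet → ℤˣ

namespace SignedGraph

variable {V W : Type*}

/-- The sign of the edge `uv`. -/
def edgeSign (Γ : SignedGraph V) {u v : V} (h : Γ.graph.Adj u v) : ℤˣ :=
  Γ.sign ⟨s(u, v), h⟩

/-- The sign of a walk: the product of the signs of its edges, with multiplicity. -/
def walkSign (Γ : SignedGraph V) : {u v : V} → Γ.graph.Walk u v → ℤˣ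
  | _, _, .nil => 1
  | _, _, .cons h p => Γ.edgeSign h * walkSign Γ p

/-- `Γ` contains a negative (unbalanced) cycle of length `r` as a subgraph. -/
def HasNegativeCycle (Γ : SignedGraph V) (r : ℕ) : Prop :=
  ∃ (u : V) (c : Γ.graph.Walk u u), c.IsCycle ∧ c.length = r ∧ Γ.walkSign c = -1

/-- `Γ` is balanced if every cycle of `Γ` is positive. -/
def Balanced (Γ : SignedGraph V) : Prop :=
  ∀ (u : V) (c : Γ.graph.Walk u u), c.IsCycle → Γ.walkSign c = 1

open Classical in
/-- The adjacency matrix `A(Γ)`: the entry at `(u, v)` is `σ(uv)` if `u` and `v` are adjacent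
and `0` otherwise. -/
noncomputable def adjMatrix (Γ : SignedGraph V) : Matrix V V ℝ :=
  Matrix.of fun u v => if h : Γ.graph.Adj u v then (((Γ.edgeSign h : ℤˣ) : ℤ) : ℝ) else 0

/-- The index `λ₁(Γ)`: the largest eigenvalue of the adjacency matrix. (For a finite nonempty
vertex set the supremum is attained, see `isGreatest_index`.) -/
noncomputable def index [Fintype V] (Γ : SignedGraph V) : ℝ :=
  sSup {μ : ℝ | Module.End.HasEigenvalue Γ.adjMatrix.mulVecLin μ}

/-- Switching `Γ` by `θ : V → {1, -1}`: the sign of each edge `uv` is multiplied by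
`θ(u) θ(v)`. Equivalently, all edges between `{v | θ v = -1}` and its complement are
reversed. -/
def switch (Γ : SignedGraph V) (θ : V → ℤˣ) : SignedGraph V where
  graph := Γ.graph
  sign e := Sym2.lift ⟨fun u v => θ u * θ v, fun u v => mul_comm (θ u) (θ v)⟩ e.1 * Γ.sign e

/-- Signed graphs are isomorphic if there is an isomorphism of the underlying graphs that
preserves the sign of every edge. -/
def Isomorphic (Γ : SignedGraph V) (Γ' : SignedGraph W) : Prop :=
  ∃ f : Γ.graph ≃g Γ'.graph, ∀ (u v : V) (h : Γ.graph.Adj u v),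
    Γ'.edgeSign (f.map_adj_iff.mpr h) = Γ.edgeSign h

/-- Switching equivalence `Γ ∼ Γ'`, for unlabelled signed graphs: some switching of `Γ` is
isomorphic to `Γ'`. -/
def SwitchingEquiv (Γ : SignedGraph V) (Γ' : SignedGraph W) : Prop :=
  ∃ θ : V → ℤˣ, (Γ.switch θ).Isomorphic Γ'

/-- `Γ₁ = C₃⁻ • K_{n-2}` on the vertices `0, …, n-1` (meant for `3 ≤ n`). The vertices `0, 1, 2`
form the triangle `C₃⁻`, whose only negative edge is `01`; the vertices `2, …, n-1` form an
all-positive complete graph `K_{n-2}`; the two parts share the vertex `2`. -/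
def gammaOne (n : ℕ) : SignedGraph (Fin n) where
  graph :=
    { Adj := fun u v => u ≠ v ∧ ((u.val ≤ 2 ∧ v.val ≤ 2) ∨ (2 ≤ u.val ∧ 2 ≤ v.val))
      symm := ⟨fun _ _ h => ⟨h.1.symm, h.2.imp And.symm And.symm⟩⟩
      loopless := ⟨fun _ h => h.1 rfl⟩ }
  sign e := if ∀ u ∈ e.1, u.val ≤ 1 then -1 else 1

theorem adjMatrix_isHermitian (Γ : SignedGraph V) : Γ.adjMatrix.IsHermitian := by
  ext u v
  simp only [Matrix.conjTranspose_apply, adjMatrix, Matrix.of_apply, star_trivial]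
  by_cases h : Γ.graph.Adj u v
  · have e : Γ.edgeSign h.symm = Γ.edgeSign h := by
      unfold edgeSign
      congr 1
      exact Subtype.ext Sym2.eq_swap
    rw [dif_pos h, dif_pos h.symm, e]
  · rw [dif_neg h, dif_neg fun h' => h h'.symm]

/-- On a finite nonempty vertex set the index is the largest eigenvalue. -/
theorem isGreatest_index [Fintype V] [Nonempty V] (Γ : SignedGraph V) :
    IsGreatest {μ : ℝ | Module.End.HasEigenvalue Γ.adjMatrix.mulVecLin μ} Γ.index := by
  classical
  have hfin : {μ : ℝ | Module.End.HasEigenvalue Γ.adjMatrix.mulVecLin μ}.Finite :=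
    Module.End.finite_hasEigenvalue _
  have hne : {μ : ℝ | Module.End.HasEigenvalue Γ.adjMatrix.mulVecLin μ}.Nonempty := by
    obtain ⟨i⟩ := ‹Nonempty V›
    refine ⟨Γ.adjMatrix_isHermitian.eigenvalues i, ?_⟩
    refine Module.End.hasEigenvalue_of_hasEigenvector
      (x := ⇑(Γ.adjMatrix_isHermitian.eigenvectorBasis i)) ⟨?_, ?_⟩
    · rw [Module.End.mem_eigenspace_iff]
      exact Γ.adjMatrix_isHermitian.mulVec_eigenvectorBasis i
    · intro h
      apply Γ.adjMatrix_isHermitian.eigenvectorBasis.orthonormal.ne_zero i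
      ext j
      exact congrFun h j
  exact ⟨hne.csSup_mem hfin, fun μ hμ => le_csSup hfin.bddAbove hμ⟩

end SignedGraph

/-!
After switching, the index has a nonnegative eigenvector `x` with largest entry `1`. Since
`λ₁ ≥ λ₁(Γ₁) > n - 3`, the eigenvalue equation at an entry equal to `1` shows that the deficiencies
`1 - x a` add up to less than `2`. Let `uv` be a negative edge and suppose that there is no negative
pentagon. If `a ≠ c` are positive neighbours of `u` and of `v`, then `a` and `c` have no common
positive neighbour outside `{u, v}`, and the eigenvalue equations at `a` and `c` force their
deficiencies to add up to at least `1/2`. Many disjoint such pairs would exceed the total,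
whereas few positive neighbours of `u` and `v` make `x u` and `x v` small, which costs deficiency
too. Hence `u` and `v` have exactly one positive neighbour `w` each, the same for both. With
`u, v, w` placed at `0, 1, 2` this says that `A(Γ) ≤ A(Γ₁)` entrywise, so `x` is also a top
eigenvector of `A(Γ₁)` and the two matrices agree.
-/

open Finset Matrix

section LinearAlgebra

variable {V : Type*} [Fintype V] {A B : Matrix V V ℝ} {r : ℝ} {x : V → ℝ}

theorem posSemidef_smul_one_sub [DecidableEq V] (hB : B.IsHermitian)
    (hr : ∀ μ, Module.End.HasEigenvalue B.mulVecLin μ → μ ≤ r) :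
    (r • (1 : Matrix V V ℝ) - B).PosSemidef := by
  refine posSemidef_iff_isHermitian_and_spectrum_nonneg.mpr
    ⟨(isHermitian_one.smul (IsSelfAdjoint.all r)).sub hB, ?_⟩
  rw [← Algebra.algebraMap_eq_smul_one, ← spectrum.singleton_sub_eq, ← spectrum_toLin']
  rintro _ ⟨_, rfl, μ, hμ, rfl⟩
  exact sub_nonneg.mpr (hr μ (Module.End.hasEigenvalue_iff_mem_spectrum.mpr hμ))

theorem mulVec_eq_smul_of_le_dotProduct [DecidableEq V]
    (hB : (r • (1 : Matrix V V ℝ) - B).PosSemidef) (hx : r * (x ⬝ᵥ x) ≤ x ⬝ᵥ B *ᵥ x) :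
    B *ᵥ x = r • x := by
  have hmul : (r • (1 : Matrix V V ℝ) - B) *ᵥ x = r • x - B *ᵥ x := by
    rw [sub_mulVec, smul_mulVec, one_mulVec]
  have hform : star x ⬝ᵥ (r • (1 : Matrix V V ℝ) - B) *ᵥ x = r * (x ⬝ᵥ x) - x ⬝ᵥ B *ᵥ x := by
    rw [hmul, star_trivial, dotProduct_sub, dotProduct_smul, smul_eq_mul]
  have hzero : star x ⬝ᵥ (r • (1 : Matrix V V ℝ) - B) *ᵥ x = 0 :=
    le_antisymm (by linarith) (hB.dotProduct_mulVec_nonneg x)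
  rw [hB.dotProduct_mulVec_zero_iff, hmul] at hzero
  exact (sub_eq_zero.mp hzero).symm

theorem eq_of_le_of_mulVec_eq_smul [DecidableEq V] (hA : A.IsSymm) (hB : B.IsSymm)
    (hdiag : ∀ a, A a a = B a a) (hle : ∀ a b, A a b ≤ B a b)
    (hBr : (r • (1 : Matrix V V ℝ) - B).PosSemidef) (hx : ∀ a, 0 ≤ x a)
    (hpos : ∀ a b, a ≠ b → 0 < x a + x b) (hAx : A *ᵥ x = r • x) : A = B := by
  have hterm (a b : V) : A a b * x b ≤ B a b * x b := mul_le_mul_of_nonneg_right (hle a b) (hx b)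
  have hBx : B *ᵥ x = r • x := mulVec_eq_smul_of_le_dotProduct hBr <|
    calc r * (x ⬝ᵥ x) = x ⬝ᵥ A *ᵥ x := by rw [hAx, dotProduct_smul, smul_eq_mul]
      _ ≤ x ⬝ᵥ B *ᵥ x := sum_le_sum fun a _ =>
        mul_le_mul_of_nonneg_left (sum_le_sum fun b _ => hterm a b) (hx a)
  have hcol (a b : V) (hb : x b ≠ 0) : A a b = B a b := by
    have hrow : ∑ b, A a b * x b = ∑ b, B a b * x b := congrFun (hAx.trans hBx.symm) a
    exact mul_right_cancel₀ hb
      ((sum_eq_sum_iff_of_le fun b _ => hterm a b).mp hrow b (mem_univ b))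
  ext a b
  by_cases hab : a = b
  · exact hab ▸ hdiag a
  by_cases hb : x b = 0
  · have ha : 0 < x a := by simpa [hb] using hpos a b hab
    rw [← hA.apply a b, ← hB.apply a b, hcol b a ha.ne']
  · exact hcol a b hb

end LinearAlgebra

theorem exists_equiv_fin_extending {V : Type*} [Fintype V] {n k : ℕ} (hcard : Fintype.card V = n)
    (g : Fin k ↪ V) : ∃ f : V ≃ Fin n, ∀ i, (f (g i)).val = i := by
  have hkn : k ≤ n := by simpa [hcard] using Fintype.card_le_of_embedding g
  let e : V ≃ Fin n := Fintype.equivFinOfCardEq hcard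
  have := Equiv.Perm.isMultiplyPretransitive (Fin n) k
  obtain ⟨σ, hσ⟩ := MulAction.exists_smul_eq (Equiv.Perm (Fin n))
    (g.trans e.toEmbedding) (Fin.castLEEmb hkn)
  exact ⟨e.trans σ, fun i => congrArg Fin.val (DFunLike.congr_fun hσ i)⟩

theorem card_mul_le_sum_add_sum {V : Type*} {d : V → ℝ} {t : ℝ} {A C : Finset V}
    (hcard : #A = #C) (h : ∀ a ∈ A, ∀ c ∈ C, t ≤ d a + d c) :
    #A * t ≤ ∑ a ∈ A, d a + ∑ c ∈ C, d c := by
  let e := equivOfCardEq hcard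
  calc #A * t = ∑ _a : A, t := by simp
    _ ≤ ∑ a : A, (d a + d (e a)) := sum_le_sum fun a _ => h a a.2 (e a) (e a).2
    _ = ∑ a ∈ A, d a + ∑ c ∈ C, d c := by
      rw [sum_add_distrib, e.sum_comp fun c : C => d c, sum_coe_sort, sum_coe_sort]

namespace SignedGraph

section AdjMatrix

variable {V W : Type*} (Γ : SignedGraph V)

theorem adjMatrix_of_adj {u v : V} (h : Γ.graph.Adj u v) :
    Γ.adjMatrix u v = ((Γ.edgeSign h : ℤ) : ℝ) := by
  simp [adjMatrix, h]

theorem adjMatrix_of_not_adj {u v : V} (h : ¬Γ.graph.Adj u v) : Γ.adjMatrix u v = 0 := by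
  simp [adjMatrix, h]

theorem adjMatrix_ne_zero_iff {u v : V} : Γ.adjMatrix u v ≠ 0 ↔ Γ.graph.Adj u v :=
  ⟨fun h => not_imp_comm.mp Γ.adjMatrix_of_not_adj h, fun h => by simp [Γ.adjMatrix_of_adj h]⟩

theorem adjMatrix_isSymm : Γ.adjMatrix.IsSymm :=
  isHermitian_iff_isSymm.mp Γ.adjMatrix_isHermitian

theorem adjMatrix_comm (u v : V) : Γ.adjMatrix u v = Γ.adjMatrix v u :=
  Γ.adjMatrix_isSymm.apply v u

theorem adjMatrix_self (u : V) : Γ.adjMatrix u u = 0 :=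
  Γ.adjMatrix_of_not_adj Γ.graph.irrefl

theorem adjMatrix_trichotomy (u v : V) :
    Γ.adjMatrix u v = -1 ∨ Γ.adjMatrix u v = 0 ∨ Γ.adjMatrix u v = 1 := by
  by_cases h : Γ.graph.Adj u v
  · rw [Γ.adjMatrix_of_adj h]
    rcases Int.units_eq_one_or (Γ.edgeSign h) with h | h <;> simp [h]
  · exact Or.inr (Or.inl (Γ.adjMatrix_of_not_adj h))

theorem adjMatrix_le_one (u v : V) : Γ.adjMatrix u v ≤ 1 := by
  rcases Γ.adjMatrix_trichotomy u v with h | h | h <;> norm_num [h]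

variable {Γ}

theorem ne_of_adjMatrix_ne_zero {u v : V} (h : Γ.adjMatrix u v ≠ 0) : u ≠ v :=
  (Γ.adjMatrix_ne_zero_iff.mp h).ne

theorem ne_of_adjMatrix_eq_neg_one {u v : V} (h : Γ.adjMatrix u v = -1) : u ≠ v :=
  ne_of_adjMatrix_ne_zero (Γ := Γ) (by norm_num [h])

theorem exists_edgeSign_eq {u v : V} {s : ℤˣ} (h : Γ.adjMatrix u v = ((s : ℤ) : ℝ)) :
    ∃ e : Γ.graph.Adj u v, Γ.edgeSign e = s := by
  have e : Γ.graph.Adj u v := Γ.adjMatrix_ne_zero_iff.mp (by simp [h])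
  rw [Γ.adjMatrix_of_adj e] at h
  exact ⟨e, Units.ext (by exact_mod_cast h)⟩

theorem isomorphic_of_adjMatrix_eq {Γ' : SignedGraph W} (f : V ≃ W)
    (h : Γ.adjMatrix = Γ'.adjMatrix.submatrix f f) : Γ.Isomorphic Γ' := by
  have hentry (a b : V) : Γ.adjMatrix a b = Γ'.adjMatrix (f a) (f b) := congrFun₂ h a b
  have hadj (a b : V) : Γ'.graph.Adj (f a) (f b) ↔ Γ.graph.Adj a b := by
    rw [← adjMatrix_ne_zero_iff, ← adjMatrix_ne_zero_iff, hentry]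
  refine ⟨⟨f, hadj _ _⟩, fun a b e => ?_⟩
  have hsign := hentry a b
  rw [Γ.adjMatrix_of_adj e, Γ'.adjMatrix_of_adj ((hadj a b).mpr e)] at hsign
  exact Units.ext (by exact_mod_cast hsign.symm)

end AdjMatrix

section Switch

variable {V : Type*} (Γ : SignedGraph V) (θ : V → ℤˣ)

theorem edgeSign_switch {u v : V} (h : Γ.graph.Adj u v) :
    (Γ.switch θ).edgeSign (u := u) (v := v) h = θ u * θ v * Γ.edgeSign h := rfl

theorem adjMatrix_switch (u v : V) :
    (Γ.switch θ).adjMatrix u v = ((θ u : ℤ) : ℝ) * ((θ v : ℤ) : ℝ) * Γ.adjMatrix u v := by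
  by_cases h : Γ.graph.Adj u v
  · rw [Γ.adjMatrix_of_adj h, (Γ.switch θ).adjMatrix_of_adj (u := u) (v := v) h,
      Γ.edgeSign_switch]
    push_cast
    rfl
  · rw [Γ.adjMatrix_of_not_adj h, (Γ.switch θ).adjMatrix_of_not_adj (u := u) (v := v) h, mul_zero]

theorem adjMatrix_switch_mulVec [Fintype V] (y : V → ℝ) :
    (Γ.switch θ).adjMatrix *ᵥ (fun a => ((θ a : ℤ) : ℝ) * y a) =
      fun a => ((θ a : ℤ) : ℝ) * (Γ.adjMatrix *ᵥ y) a := by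
  have hθ (b : V) : ((θ b : ℤ) : ℝ) * ((θ b : ℤ) : ℝ) = 1 := by
    rcases Int.units_eq_one_or (θ b) with h | h <;> simp [h]
  ext a
  simp only [mulVec, dotProduct, mul_sum, adjMatrix_switch]
  exact sum_congr rfl fun b _ => by
    linear_combination ((θ a : ℤ) : ℝ) * Γ.adjMatrix a b * y b * hθ b

theorem walkSign_switch {u v : V} (p : Γ.graph.Walk u v) :
    (Γ.switch θ).walkSign (u := u) (v := v) p = θ u * θ v * Γ.walkSign p := by
  induction p with
  | nil => simp [walkSign, Int.units_mul_self]
  | @cons a b c h p ih =>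
    calc (Γ.switch θ).edgeSign (u := a) (v := b) h * (Γ.switch θ).walkSign (u := b) (v := c) p
        = θ a * θ b * Γ.edgeSign h * (θ b * θ c * Γ.walkSign p) := by rw [ih, Γ.edgeSign_switch]
      _ = (θ b * θ b) * (θ a * θ c * (Γ.edgeSign h * Γ.walkSign p)) := by ac_rfl
      _ = θ a * θ c * (Γ.edgeSign h * Γ.walkSign p) := by rw [Int.units_mul_self, one_mul]

theorem walkSign_switch_closed {u : V} (p : Γ.graph.Walk u u) :
    (Γ.switch θ).walkSign (u := u) (v := u) p = Γ.walkSign p := by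
  rw [walkSign_switch, Int.units_mul_self, one_mul]

variable {Γ θ}

theorem HasNegativeCycle.of_switch {r : ℕ} (h : (Γ.switch θ).HasNegativeCycle r) :
    Γ.HasNegativeCycle r := by
  obtain ⟨u, c, hc, hr, hs⟩ := h
  exact ⟨u, c, hc, hr, (Γ.walkSign_switch_closed θ c).symm.trans hs⟩

theorem Balanced.of_switch (h : (Γ.switch θ).Balanced) : Γ.Balanced :=
  fun u c hc => (Γ.walkSign_switch_closed θ c).symm.trans (h u c hc)

end Switch

section Cycles

variable {V : Type*} {Γ : SignedGraph V}

theorem walkSign_eq_one (h : ∀ u v (e : Γ.graph.Adj u v), Γ.edgeSign e = 1) {u v : V}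
    (p : Γ.graph.Walk u v) : Γ.walkSign p = 1 := by
  induction p with
  | nil => rfl
  | cons e p ih => rw [walkSign, ih, h, one_mul]

theorem exists_adjMatrix_eq_neg_one (h : ¬Γ.Balanced) : ∃ u v, Γ.adjMatrix u v = -1 := by
  by_contra! hne
  refine h fun u c _ => walkSign_eq_one (fun u v e => ?_) c
  refine (Int.units_eq_one_or _).resolve_right fun hs => hne u v ?_
  rw [Γ.adjMatrix_of_adj e, hs]
  norm_num

theorem hasNegativeCycle_five {u v a b c : V} (hvu : Γ.adjMatrix v u = -1)
    (hua : Γ.adjMatrix u a = 1) (hab : Γ.adjMatrix a b = 1) (hbc : Γ.adjMatrix b c = 1)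
    (hcv : Γ.adjMatrix c v = 1) (hac : a ≠ c) (hbu : b ≠ u) (hbv : b ≠ v) :
    Γ.HasNegativeCycle 5 := by
  have hcu : c ≠ u := by rintro rfl; norm_num [Γ.adjMatrix_comm v, hcv] at hvu
  have hav : a ≠ v := by rintro rfl; norm_num [Γ.adjMatrix_comm a, hua] at hvu
  obtain ⟨evu, hevu⟩ := exists_edgeSign_eq (s := -1) (by simpa using hvu)
  obtain ⟨eua, heua⟩ := exists_edgeSign_eq (s := 1) (by simpa using hua)
  obtain ⟨eab, heab⟩ := exists_edgeSign_eq (s := 1) (by simpa using hab)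
  obtain ⟨ebc, hebc⟩ := exists_edgeSign_eq (s := 1) (by simpa using hbc)
  obtain ⟨ecv, hecv⟩ := exists_edgeSign_eq (s := 1) (by simpa using hcv)
  let p : Γ.graph.Walk u v := .cons eua (.cons eab (.cons ebc (.cons ecv .nil)))
  have hpath : p.IsPath := by
    simp only [p, SimpleGraph.Walk.isPath_def, SimpleGraph.Walk.support_cons,
      SimpleGraph.Walk.support_nil]
    grind [SimpleGraph.Adj.ne]
  have hedge : s(v, u) ∉ p.edges := by
    simp only [p, SimpleGraph.Walk.edges_cons, SimpleGraph.Walk.edges_nil, List.mem_cons,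
      List.not_mem_nil, Sym2.eq_iff]
    grind [SimpleGraph.Adj.ne]
  exact ⟨v, .cons evu p, (SimpleGraph.Walk.cons_isCycle_iff p evu).mpr ⟨hpath, hedge⟩, rfl,
    by simp [p, walkSign, hevu, heua, heab, hebc, hecv]⟩

end Cycles

section GammaOne

theorem posSemidef_smul_one_sub_adjMatrix {V : Type*} [Fintype V] [DecidableEq V] [Nonempty V]
    {Γ : SignedGraph V} {r : ℝ} (h : Γ.index ≤ r) :
    (r • (1 : Matrix V V ℝ) - Γ.adjMatrix).PosSemidef :=
  posSemidef_smul_one_sub Γ.adjMatrix_isHermitian fun _ hμ => (Γ.isGreatest_index.2 hμ).trans h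

theorem adjMatrix_gammaOne_apply {n : ℕ} (i j : Fin n) :
    (gammaOne n).adjMatrix i j =
      if i = j then 0 else if i.val ≤ 1 ∧ j.val ≤ 1 then -1
      else if (i.val ≤ 2 ∧ j.val ≤ 2) ∨ (2 ≤ i.val ∧ 2 ≤ j.val) then 1 else 0 := by
  by_cases h : (gammaOne n).graph.Adj i j
  · have hsign : (gammaOne n).edgeSign h = if i.val ≤ 1 ∧ j.val ≤ 1 then -1 else 1 := by
      simp [edgeSign, gammaOne]
    rw [adjMatrix_of_adj _ h, hsign, if_neg h.1, if_pos h.2]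
    split_ifs <;> simp
  · have hnot : ¬(i ≠ j ∧ ((i.val ≤ 2 ∧ j.val ≤ 2) ∨ (2 ≤ i.val ∧ 2 ≤ j.val))) := h
    rw [adjMatrix_of_not_adj _ h]
    split_ifs <;> first | rfl | omega

theorem adjMatrix_gammaOne_mulVec_indicator {n : ℕ} (hn : 3 ≤ n) (i : Fin n) :
    ((gammaOne n).adjMatrix *ᵥ fun j => if 2 ≤ j.val then 1 else 0) i =
      if 2 ≤ i.val then (n : ℝ) - 3 else 1 := by
  simp only [mulVec, dotProduct]
  split_ifs with hi
  · have hsum : ∑ j : Fin n, (if 2 ≤ j.val then (1 : ℝ) else 0) = n - 2 := by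
      obtain ⟨m, rfl⟩ := Nat.exists_eq_add_of_le' hn
      simp only [Fin.sum_univ_succ, Fin.val_succ, Fin.val_zero]
      norm_num
      ring
    calc ∑ j, (gammaOne n).adjMatrix i j * (if 2 ≤ j.val then 1 else 0)
        = ∑ j, ((if 2 ≤ j.val then 1 else 0) - if i = j then 1 else 0) := by
          refine sum_congr rfl fun j _ => ?_
          rw [adjMatrix_gammaOne_apply]
          grind
      _ = (n : ℝ) - 3 := by
          rw [sum_sub_distrib, hsum, sum_ite_eq, if_pos (mem_univ i)]
          ring
  · rw [sum_eq_single ⟨2, hn⟩ _ (by simp)]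
    · rw [adjMatrix_gammaOne_apply]
      grind
    · intro j _ hj
      rw [adjMatrix_gammaOne_apply]
      grind

theorem sub_three_lt_index_gammaOne {n : ℕ} (hn : 3 ≤ n) : (n : ℝ) - 3 < (gammaOne n).index := by
  have : Nonempty (Fin n) := ⟨⟨0, by omega⟩⟩
  by_contra! hle
  -- The indicator of `K_{n-2}` has Rayleigh quotient `n - 3` but is not an eigenvector.
  set z : Fin n → ℝ := fun j => if 2 ≤ j.val then 1 else 0
  have hform : z ⬝ᵥ (gammaOne n).adjMatrix *ᵥ z = ((n : ℝ) - 3) * (z ⬝ᵥ z) := by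
    rw [← smul_eq_mul, ← dotProduct_smul]
    refine sum_congr rfl fun i _ => ?_
    rw [adjMatrix_gammaOne_mulVec_indicator hn]
    by_cases hi : 2 ≤ i.val <;> simp [z, hi]
  have heigen := mulVec_eq_smul_of_le_dotProduct (posSemidef_smul_one_sub_adjMatrix hle) hform.ge
  have hzero := congrFun heigen ⟨0, by omega⟩
  rw [adjMatrix_gammaOne_mulVec_indicator hn] at hzero
  simp [z] at hzero

end GammaOne

section SignedNeighbors

variable {V : Type*} [Fintype V]

/-- The set of vertices joined to `a` by a positive edge. -/
noncomputable def posNeighborFinset (Γ : SignedGraph V) (a : V) : Finset V :=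
  {b | Γ.adjMatrix a b = 1}

/-- The set of vertices joined to `a` by a negative edge. -/
noncomputable def negNeighborFinset (Γ : SignedGraph V) (a : V) : Finset V :=
  {b | Γ.adjMatrix a b = -1}

variable {Γ : SignedGraph V} {u v a b c : V}

@[simp]
theorem mem_posNeighborFinset : b ∈ Γ.posNeighborFinset a ↔ Γ.adjMatrix a b = 1 := by
  simp [posNeighborFinset]

@[simp]
theorem mem_negNeighborFinset : b ∈ Γ.negNeighborFinset a ↔ Γ.adjMatrix a b = -1 := by
  simp [negNeighborFinset]

theorem adjMatrix_mulVec_apply (x : V → ℝ) (a : V) :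
    (Γ.adjMatrix *ᵥ x) a =
      ∑ b ∈ Γ.posNeighborFinset a, x b - ∑ b ∈ Γ.negNeighborFinset a, x b := by
  rw [posNeighborFinset, negNeighborFinset, sum_filter, sum_filter, ← sum_sub_distrib]
  refine sum_congr rfl fun b _ => ?_
  rcases Γ.adjMatrix_trichotomy a b with h | h | h <;> norm_num [h]

theorem notMem_posNeighborFinset_self : a ∉ Γ.posNeighborFinset a := by
  simp [adjMatrix_self]

theorem notMem_posNeighborFinset_of_neg (huv : Γ.adjMatrix u v = -1) :
    v ∉ Γ.posNeighborFinset u := by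
  norm_num [huv]

theorem disjoint_pair_posNeighborFinset_union [DecidableEq V] (huv : Γ.adjMatrix u v = -1) :
    Disjoint {u, v} (Γ.posNeighborFinset u ∪ Γ.posNeighborFinset v) := by
  have hvu : Γ.adjMatrix v u = -1 := Γ.adjMatrix_comm v u ▸ huv
  simp only [disjoint_insert_left, disjoint_singleton_left, mem_union, not_or]
  exact ⟨⟨notMem_posNeighborFinset_self, notMem_posNeighborFinset_of_neg hvu⟩,
    notMem_posNeighborFinset_of_neg huv, notMem_posNeighborFinset_self⟩

theorem posNeighborFinset_inter_subset [DecidableEq V] (h5 : ¬Γ.HasNegativeCycle 5)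
    (huv : Γ.adjMatrix u v = -1) (ha : a ∈ Γ.posNeighborFinset u)
    (hc : c ∈ Γ.posNeighborFinset v) (hac : a ≠ c) :
    Γ.posNeighborFinset a ∩ Γ.posNeighborFinset c ⊆ {u, v} := by
  intro b hb
  simp only [mem_inter, mem_posNeighborFinset] at ha hc hb
  by_contra hbuv
  simp only [mem_insert, mem_singleton, not_or] at hbuv
  rw [adjMatrix_comm] at huv hc
  exact h5 (hasNegativeCycle_five huv ha hb.1 (Γ.adjMatrix_comm b c ▸ hb.2) hc hac hbuv.1 hbuv.2)

theorem adjMatrix_nonpos (h : b ∉ Γ.posNeighborFinset a) : Γ.adjMatrix a b ≤ 0 := by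
  rw [mem_posNeighborFinset] at h
  rcases Γ.adjMatrix_trichotomy a b with h' | h' | h'
  · norm_num [h']
  · exact h'.le
  · exact absurd h' h

theorem adjMatrix_le_adjMatrix_gammaOne {n : ℕ} {w : V} (huv : Γ.adjMatrix u v = -1)
    (hu : Γ.posNeighborFinset u = {w}) (hv : Γ.posNeighborFinset v = {w}) {f : V ≃ Fin n}
    (hfu : (f u).val = 0) (hfv : (f v).val = 1) (hfw : (f w).val = 2) (a b : V) :
    Γ.adjMatrix a b ≤ (gammaOne n).adjMatrix (f a) (f b) := by
  have hvertex {a z : V} (h : (f a).val = (f z).val) : a = z := f.injective (Fin.ext h)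
  have hlow {a b : V} (ha : (f a).val ≤ 1) (hb : (f b).val ≠ 2) : Γ.adjMatrix a b ≤ 0 := by
    have hbw : b ≠ w := by rintro rfl; exact hb hfw
    have ha' : a = u ∨ a = v := by
      rcases Nat.le_one_iff_eq_zero_or_eq_one.mp ha with h | h
      · exact Or.inl (hvertex (h.trans hfu.symm))
      · exact Or.inr (hvertex (h.trans hfv.symm))
    apply adjMatrix_nonpos
    rcases ha' with rfl | rfl <;> simpa [hu, hv] using hbw
  rw [adjMatrix_gammaOne_apply]
  split_ifs with hab hlow2 hedge
  · rw [f.injective hab, adjMatrix_self]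
  · have hne : (f a).val ≠ (f b).val := fun h => hab (Fin.ext h)
    rcases Nat.le_one_iff_eq_zero_or_eq_one.mp hlow2.1 with h | h
    · rw [hvertex (h.trans hfu.symm), hvertex (a := b) (z := v) (by omega), huv]
    · rw [hvertex (h.trans hfv.symm), hvertex (a := b) (z := u) (by omega), adjMatrix_comm, huv]
  · exact Γ.adjMatrix_le_one a b
  · rcases Nat.lt_or_ge (f a).val 2 with ha | ha
    · exact hlow (by omega) (by omega)
    · rw [adjMatrix_comm]
      exact hlow (by omega) (by omega)

end SignedNeighbors

/-- `x` is an entrywise nonnegative eigenvector of the adjacency matrix for the eigenvalue `r`,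
scaled so that its largest entry is `1`. A suitable switching has one for the index; the argument
is in terms of the deficiencies `1 - x a`. -/
structure IsNonnegEigenvector {V : Type*} [Fintype V] (Γ : SignedGraph V) (r : ℝ) (x : V → ℝ) :
    Prop where
  nonneg : ∀ a, 0 ≤ x a
  le_one : ∀ a, x a ≤ 1
  exists_eq_one : ∃ a, x a = 1
  mulVec_eq : Γ.adjMatrix *ᵥ x = r • x

theorem exists_isNonnegEigenvector_switch {V : Type*} [Fintype V] [Nonempty V]
    (Γ : SignedGraph V) : ∃ θ x, (Γ.switch θ).IsNonnegEigenvector Γ.index x := by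
  obtain ⟨y, hy⟩ := Γ.isGreatest_index.1.exists_hasEigenvector
  obtain ⟨m, hm⟩ := Finite.exists_max fun a => |y a|
  have hpos : 0 < |y m| := abs_pos.mpr fun hym => hy.2 <| funext fun a => by
    simpa [hym] using hm a
  let θ : V → ℤˣ := fun a => if y a < 0 then -1 else 1
  have hθ : |y| = fun a => ((θ a : ℤ) : ℝ) * y a := by
    ext a
    by_cases h : y a < 0
    · simp [θ, h, abs_of_neg]
    · simp [θ, h, abs_of_nonneg (not_lt.mp h)]
  have heigen : (Γ.switch θ).adjMatrix *ᵥ |y| = Γ.index • |y| := by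
    have hAy : Γ.adjMatrix *ᵥ y = Γ.index • y := hy.apply_eq_smul
    rw [hθ, adjMatrix_switch_mulVec, hAy]
    ext a
    simp [mul_left_comm]
  refine ⟨θ, |y m|⁻¹ • |y|, ⟨fun a => ?_, fun a => ?_, ⟨m, ?_⟩, ?_⟩⟩
  · exact mul_nonneg (inv_nonneg.mpr hpos.le) (abs_nonneg (y a))
  · simpa [inv_mul_le_one₀ hpos] using hm a
  · simpa using inv_mul_cancel₀ hpos.ne'
  · rw [mulVec_smul, heigen, smul_comm]

namespace IsNonnegEigenvector

variable {V : Type*} [Fintype V] {Γ : SignedGraph V} {r : ℝ} {x : V → ℝ} {u v a c : V}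

theorem mul_le_sum_posNeighborFinset (h : Γ.IsNonnegEigenvector r x) (a : V) :
    r * x a ≤ ∑ b ∈ Γ.posNeighborFinset a, x b := by
  have heigen := congrFun h.mulVec_eq a
  rw [adjMatrix_mulVec_apply, Pi.smul_apply, smul_eq_mul] at heigen
  linarith [sum_nonneg fun b (_ : b ∈ Γ.negNeighborFinset a) => h.nonneg b]

theorem mul_add_le_sum_posNeighborFinset (h : Γ.IsNonnegEigenvector r x)
    (huv : Γ.adjMatrix u v = -1) :
    r * x u + x v ≤ ∑ b ∈ Γ.posNeighborFinset u, x b := by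
  have heigen := congrFun h.mulVec_eq u
  rw [adjMatrix_mulVec_apply, Pi.smul_apply, smul_eq_mul] at heigen
  linarith [single_le_sum (fun b _ => h.nonneg b) (mem_negNeighborFinset.mpr huv)]

theorem mul_add_le_card_posNeighborFinset (h : Γ.IsNonnegEigenvector r x)
    (huv : Γ.adjMatrix u v = -1) :
    r * x u + x v ≤ #(Γ.posNeighborFinset u) :=
  (h.mul_add_le_sum_posNeighborFinset huv).trans <| by
    simpa using sum_le_card_nsmul (Γ.posNeighborFinset u) x 1 fun b _ => h.le_one b

theorem add_one_le_sum (h : Γ.IsNonnegEigenvector r x) : r + 1 ≤ ∑ a, x a := by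
  classical
  obtain ⟨m, hm⟩ := h.exists_eq_one
  have hsub : Γ.posNeighborFinset m ⊆ univ.erase m := fun b hb =>
    mem_erase.mpr ⟨fun hbm => notMem_posNeighborFinset_self (hbm ▸ hb), mem_univ b⟩
  calc r + 1 = r * x m + x m := by rw [hm, mul_one]
    _ ≤ ∑ b ∈ univ.erase m, x b + x m := by
      gcongr
      exact (h.mul_le_sum_posNeighborFinset m).trans
        (sum_le_sum_of_subset_of_nonneg hsub fun b _ _ => h.nonneg b)
    _ = ∑ a, x a := sum_erase_add univ x (mem_univ m)

theorem sum_one_sub_le (h : Γ.IsNonnegEigenvector r x) (T : Finset V) :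
    ∑ a ∈ T, (1 - x a) ≤ Fintype.card V - ∑ a, x a :=
  calc ∑ a ∈ T, (1 - x a) ≤ ∑ a, (1 - x a) :=
        sum_le_sum_of_subset_of_nonneg (subset_univ T) fun a _ _ => sub_nonneg.mpr (h.le_one a)
    _ = Fintype.card V - ∑ a, x a := by simp [sum_sub_distrib]

theorem sum_one_sub_lt_two (h : Γ.IsNonnegEigenvector r x) (hr : (Fintype.card V : ℝ) - 3 < r)
    (T : Finset V) : ∑ a ∈ T, (1 - x a) < 2 := by
  linarith [h.sum_one_sub_le T, h.add_one_le_sum]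

theorem add_pos (h : Γ.IsNonnegEigenvector r x) (hr : (Fintype.card V : ℝ) - 3 < r)
    (hac : a ≠ c) : 0 < x a + x c := by
  classical
  have hsum := h.sum_one_sub_lt_two hr {a, c}
  rw [sum_pair hac] at hsum
  linarith

theorem posNeighborFinset_nonempty (h : Γ.IsNonnegEigenvector r x)
    (hr : (Fintype.card V : ℝ) - 3 < r) (hr0 : 0 < r) (huv : Γ.adjMatrix u v = -1) :
    (Γ.posNeighborFinset u).Nonempty := by
  by_contra hempty
  have hle := h.mul_add_le_sum_posNeighborFinset huv
  rw [not_nonempty_iff_eq_empty.mp hempty, sum_empty] at hle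
  have hpos := h.add_pos hr (ne_of_adjMatrix_eq_neg_one huv)
  have hxv : x v ≤ 0 := by linarith [mul_nonneg hr0.le (h.nonneg u)]
  have hxu : 0 < x u := by linarith
  linarith [mul_pos hr0 hxu, h.nonneg v]

theorem le_one_sub_add_one_sub_of_inter_subset [DecidableEq V] (h : Γ.IsNonnegEigenvector r x)
    (hr : (Fintype.card V : ℝ) - 3 < r) (hr9 : 9 ≤ r) (huv : u ≠ v) (hac : a ≠ c)
    (hdisj : Disjoint ({u, v} : Finset V) {a, c})
    (hinter : Γ.posNeighborFinset a ∩ Γ.posNeighborFinset c ⊆ {u, v}) :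
    1 / 2 + ((1 - x u) + (1 - x v)) / 4 ≤ (1 - x a) + (1 - x c) := by
  set s := (1 - x u) + (1 - x v) with hs
  set t := (1 - x a) + (1 - x c) with ht
  have hform : r * (x a + x c) ≤ ∑ b, x b + (x u + x v) :=
    calc r * (x a + x c)
        ≤ ∑ b ∈ Γ.posNeighborFinset a, x b + ∑ b ∈ Γ.posNeighborFinset c, x b := by
          rw [mul_add]
          exact add_le_add (h.mul_le_sum_posNeighborFinset a) (h.mul_le_sum_posNeighborFinset c)
      _ = ∑ b ∈ Γ.posNeighborFinset a ∪ Γ.posNeighborFinset c, x b +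
            ∑ b ∈ Γ.posNeighborFinset a ∩ Γ.posNeighborFinset c, x b := sum_union_inter.symm
      _ ≤ ∑ b, x b + ∑ b ∈ {u, v}, x b :=
        add_le_add (sum_le_sum_of_subset_of_nonneg (subset_univ _) fun b _ _ => h.nonneg b)
          (sum_le_sum_of_subset_of_nonneg hinter fun b _ _ => h.nonneg b)
      _ = ∑ b, x b + (x u + x v) := by rw [sum_pair huv]
  have hdef := h.sum_one_sub_le ({u, v} ∪ {a, c})
  rw [sum_union hdisj, sum_pair huv, sum_pair hac] at hdef
  -- Equivalently `t ≥ 1 - (4 - 2 * s) / (r - 1)`; as `s ≤ 2`, the worst case is `r = 9`.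
  have hbound : r - 5 + 2 * s ≤ (r - 1) * t := by
    have hxac : x a + x c = 2 - t := by rw [ht]; ring
    rw [hxac] at hform
    linarith [hs]
  have hs2 : s ≤ 2 := by linarith [h.nonneg u, h.nonneg v]
  refine le_of_mul_le_mul_left ?_ (show 0 < r - 1 by linarith)
  linarith [hbound, mul_nonneg (sub_nonneg.mpr hr9) (sub_nonneg.mpr hs2)]

theorem add_sum_one_sub_lt_two [DecidableEq V] (h : Γ.IsNonnegEigenvector r x)
    (hr : (Fintype.card V : ℝ) - 3 < r) (huv : Γ.adjMatrix u v = -1) {T : Finset V}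
    (hT : T ⊆ Γ.posNeighborFinset u ∪ Γ.posNeighborFinset v) :
    (1 - x u) + (1 - x v) + ∑ a ∈ T, (1 - x a) < 2 := by
  have hlt := h.sum_one_sub_lt_two hr ({u, v} ∪ T)
  rwa [sum_union ((disjoint_pair_posNeighborFinset_union huv).mono_right hT),
    sum_pair (ne_of_adjMatrix_eq_neg_one huv)] at hlt

theorem le_one_sub_add_one_sub (h : Γ.IsNonnegEigenvector r x)
    (hr : (Fintype.card V : ℝ) - 3 < r) (hr9 : 9 ≤ r) (h5 : ¬Γ.HasNegativeCycle 5)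
    (huv : Γ.adjMatrix u v = -1) (ha : a ∈ Γ.posNeighborFinset u)
    (hc : c ∈ Γ.posNeighborFinset v) (hac : a ≠ c) :
    1 / 2 + ((1 - x u) + (1 - x v)) / 4 ≤ (1 - x a) + (1 - x c) := by
  classical
  have hsub : {a, c} ⊆ Γ.posNeighborFinset u ∪ Γ.posNeighborFinset v :=
    insert_subset (mem_union_left _ ha) (singleton_subset_iff.mpr (mem_union_right _ hc))
  exact h.le_one_sub_add_one_sub_of_inter_subset hr hr9 (ne_of_adjMatrix_eq_neg_one huv) hac
    ((disjoint_pair_posNeighborFinset_union huv).mono_right hsub)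
    (posNeighborFinset_inter_subset h5 huv ha hc hac)

theorem add_mul_lt_two_of_matching (h : Γ.IsNonnegEigenvector r x)
    (hr : (Fintype.card V : ℝ) - 3 < r) (hr9 : 9 ≤ r) (h5 : ¬Γ.HasNegativeCycle 5)
    (huv : Γ.adjMatrix u v = -1) {A C : Finset V} (hA : A ⊆ Γ.posNeighborFinset u)
    (hC : C ⊆ Γ.posNeighborFinset v) (hdisj : Disjoint A C) (hcard : #A = #C) :
    (1 - x u) + (1 - x v) + #A * (1 / 2 + ((1 - x u) + (1 - x v)) / 4) < 2 := by
  classical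
  have hlower := card_mul_le_sum_add_sum (d := fun a => 1 - x a) hcard fun a ha c hc =>
    h.le_one_sub_add_one_sub hr hr9 h5 huv (hA ha) (hC hc)
      (disjoint_iff_ne.mp hdisj a ha c hc)
  have hupper := h.add_sum_one_sub_lt_two hr huv (union_subset_union hA hC)
  rw [sum_union hdisj] at hupper
  linarith

theorem add_mul_lt_two_of_le_card (h : Γ.IsNonnegEigenvector r x)
    (hr : (Fintype.card V : ℝ) - 3 < r) (hr9 : 9 ≤ r) (h5 : ¬Γ.HasNegativeCycle 5)
    (huv : Γ.adjMatrix u v = -1) (k : ℕ) (hkv : k ≤ #(Γ.posNeighborFinset v))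
    (hku : 2 * k ≤ #(Γ.posNeighborFinset u)) :
    (1 - x u) + (1 - x v) + k * (1 / 2 + ((1 - x u) + (1 - x v)) / 4) < 2 := by
  classical
  obtain ⟨C, hC, hCk⟩ := exists_subset_card_eq hkv
  have hk : k ≤ #(Γ.posNeighborFinset u \ C) := by
    have := le_card_sdiff C (Γ.posNeighborFinset u)
    omega
  obtain ⟨A, hA, hAk⟩ := exists_subset_card_eq hk
  have hlt := h.add_mul_lt_two_of_matching hr hr9 h5 huv (hA.trans sdiff_subset) hC
    (sdiff_disjoint.mono_left hA) (hAk.trans hCk.symm)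
  rwa [hAk] at hlt

theorem one_lt_card_posNeighborFinset [DecidableEq V] (h : Γ.IsNonnegEigenvector r x)
    (hr : (Fintype.card V : ℝ) - 3 < r) (hr9 : 9 ≤ r) (h5 : ¬Γ.HasNegativeCycle 5)
    (huv : Γ.adjMatrix u v = -1) (hc : c ∈ Γ.posNeighborFinset v)
    (hcard : 1 < #((Γ.posNeighborFinset u).erase c)) : 1 < #(Γ.posNeighborFinset v) := by
  by_contra! hle
  have hsingle : Γ.posNeighborFinset v = {c} :=
    (eq_of_subset_of_card_le (singleton_subset_iff.mpr hc) (by simpa using hle)).symm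
  have hxc : x u + x v ≤ x c := by
    have hsum := h.mul_add_le_sum_posNeighborFinset (Γ.adjMatrix_comm u v ▸ huv)
    rw [hsingle, sum_singleton] at hsum
    nlinarith [h.nonneg v]
  obtain ⟨a, ha, b, hb, hab⟩ := one_lt_card.mp hcard
  rw [mem_erase] at ha hb
  have hac := h.le_one_sub_add_one_sub hr hr9 h5 huv ha.2 hc ha.1
  have hbc := h.le_one_sub_add_one_sub hr hr9 h5 huv hb.2 hc hb.1
  have hlt := h.add_sum_one_sub_lt_two hr huv (T := {a, b, c}) (by
    simp only [insert_subset_iff, singleton_subset_iff, mem_union]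
    exact ⟨Or.inl ha.2, Or.inl hb.2, Or.inr hc⟩)
  rw [sum_insert (by simp [hab, ha.1]), sum_pair hb.1] at hlt
  linarith [h.le_one u, h.le_one v]

theorem eq_of_mem_posNeighborFinset_of_card_le (h : Γ.IsNonnegEigenvector r x)
    (hr : (Fintype.card V : ℝ) - 3 < r) (hr9 : 9 ≤ r) (h5 : ¬Γ.HasNegativeCycle 5)
    (huv : Γ.adjMatrix u v = -1) (hle : #(Γ.posNeighborFinset v) ≤ #(Γ.posNeighborFinset u))
    (ha : a ∈ Γ.posNeighborFinset u) (hc : c ∈ Γ.posNeighborFinset v) : a = c := by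
  classical
  by_contra hac
  set s := (1 - x u) + (1 - x v) with hs
  have hxuv : x u + x v = 2 - s := by rw [hs]; ring
  have hxu := h.le_one u
  have hxv := h.le_one v
  have hPcard : 9 * x u + x v ≤ #(Γ.posNeighborFinset u) := by
    nlinarith [h.mul_add_le_card_posNeighborFinset huv, h.nonneg u]
  have hQcard : 9 * x v + x u ≤ #(Γ.posNeighborFinset v) := by
    nlinarith [h.mul_add_le_card_posNeighborFinset (Γ.adjMatrix_comm u v ▸ huv), h.nonneg v]
  have hmatch := h.add_mul_lt_two_of_le_card hr hr9 h5 huv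
  have hs1 : s + (1 / 2 + s / 4) < 2 := by
    simpa using h.add_mul_lt_two_of_matching hr hr9 h5 huv (singleton_subset_iff.mpr ha)
      (singleton_subset_iff.mpr hc) (disjoint_singleton.mpr hac) rfl
  have hsum8 : 8 < #(Γ.posNeighborFinset u) + #(Γ.posNeighborFinset v) := by
    rify
    linarith [hxuv]
  -- A matching of size `k` bounds `s`, and a smaller `s` forces larger positive neighbourhoods,
  -- which contain a larger matching; four edges are too many.
  have hQ2 : 2 ≤ #(Γ.posNeighborFinset v) :=
    h.one_lt_card_posNeighborFinset hr hr9 h5 huv hc (by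
      have := pred_card_le_card_erase (s := Γ.posNeighborFinset u) (a := c)
      omega)
  have hs2 : s + (2 : ℕ) * (1 / 2 + s / 4) < 2 := hmatch 2 hQ2 (by omega)
  have hQ4 : 3 < #(Γ.posNeighborFinset v) := by
    rify
    linarith [hxuv]
  have hsum14 : 13 < #(Γ.posNeighborFinset u) + #(Γ.posNeighborFinset v) := by
    rify
    linarith [hxuv]
  have hs3 : s + (3 : ℕ) * (1 / 2 + s / 4) < 2 := hmatch 3 hQ4.le (by omega)
  have hQ8 : 7 < #(Γ.posNeighborFinset v) := by
    rify
    linarith [hxuv]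
  have hs4 : s + (4 : ℕ) * (1 / 2 + s / 4) < 2 := hmatch 4 (by omega) (by omega)
  linarith

theorem eq_of_mem_posNeighborFinset (h : Γ.IsNonnegEigenvector r x)
    (hr : (Fintype.card V : ℝ) - 3 < r) (hr9 : 9 ≤ r) (h5 : ¬Γ.HasNegativeCycle 5)
    (huv : Γ.adjMatrix u v = -1) (ha : a ∈ Γ.posNeighborFinset u)
    (hc : c ∈ Γ.posNeighborFinset v) : a = c := by
  rcases le_total #(Γ.posNeighborFinset v) #(Γ.posNeighborFinset u) with hle | hle
  · exact h.eq_of_mem_posNeighborFinset_of_card_le hr hr9 h5 huv hle ha hc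
  · exact (h.eq_of_mem_posNeighborFinset_of_card_le hr hr9 h5 (Γ.adjMatrix_comm u v ▸ huv)
      hle hc ha).symm

theorem exists_posNeighborFinset_eq_singleton (h : Γ.IsNonnegEigenvector r x)
    (hr : (Fintype.card V : ℝ) - 3 < r) (hr9 : 9 ≤ r) (h5 : ¬Γ.HasNegativeCycle 5)
    (huv : Γ.adjMatrix u v = -1) :
    ∃ w, Γ.posNeighborFinset u = {w} ∧ Γ.posNeighborFinset v = {w} := by
  have hr0 : 0 < r := by linarith
  obtain ⟨w, hw⟩ := h.posNeighborFinset_nonempty hr hr0 huv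
  obtain ⟨w', hw'⟩ := h.posNeighborFinset_nonempty hr hr0 (Γ.adjMatrix_comm u v ▸ huv)
  obtain rfl := h.eq_of_mem_posNeighborFinset hr hr9 h5 huv hw hw'
  exact ⟨w, eq_singleton_iff_unique_mem.mpr
      ⟨hw, fun a ha => h.eq_of_mem_posNeighborFinset hr hr9 h5 huv ha hw'⟩,
    eq_singleton_iff_unique_mem.mpr
      ⟨hw', fun c hc => (h.eq_of_mem_posNeighborFinset hr hr9 h5 huv hw hc).symm⟩⟩

theorem adjMatrix_eq_submatrix_of_le {W : Type*} [Fintype W] [Nonempty W] {Γ' : SignedGraph W}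
    (h : Γ.IsNonnegEigenvector r x) (hr : (Fintype.card V : ℝ) - 3 < r) (hindex : Γ'.index ≤ r)
    (f : V ≃ W) (hle : ∀ a b, Γ.adjMatrix a b ≤ Γ'.adjMatrix (f a) (f b)) :
    Γ.adjMatrix = Γ'.adjMatrix.submatrix f f := by
  classical
  have hpsd : (r • (1 : Matrix V V ℝ) - Γ'.adjMatrix.submatrix f f).PosSemidef := by
    simpa [submatrix_sub, submatrix_smul] using
      (posSemidef_smul_one_sub_adjMatrix hindex).submatrix f
  exact eq_of_le_of_mulVec_eq_smul Γ.adjMatrix_isSymm (Γ'.adjMatrix_isSymm.submatrix f)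
    (fun a => by simp [adjMatrix_self]) hle hpsd h.nonneg (fun _ _ => h.add_pos hr) h.mulVec_eq

end IsNonnegEigenvector

theorem exists_equiv_adjMatrix_le_adjMatrix_gammaOne {V : Type*} [Fintype V]
    {Γ : SignedGraph V} {n : ℕ} (hcard : Fintype.card V = n) {u v w : V}
    (huv : Γ.adjMatrix u v = -1) (hu : Γ.posNeighborFinset u = {w})
    (hv : Γ.posNeighborFinset v = {w}) :
    ∃ f : V ≃ Fin n, ∀ a b, Γ.adjMatrix a b ≤ (gammaOne n).adjMatrix (f a) (f b) := by
  have huw : Γ.adjMatrix u w = 1 := mem_posNeighborFinset.mp (hu ▸ mem_singleton_self w)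
  have hvw : Γ.adjMatrix v w = 1 := mem_posNeighborFinset.mp (hv ▸ mem_singleton_self w)
  have huv_ne : u ≠ v := ne_of_adjMatrix_eq_neg_one huv
  have huw_ne : u ≠ w := ne_of_adjMatrix_ne_zero (Γ := Γ) (by norm_num [huw])
  have hvw_ne : v ≠ w := ne_of_adjMatrix_ne_zero (Γ := Γ) (by norm_num [hvw])
  have hinj : Function.Injective ![u, v, w] := by
    simp [← List.nodup_ofFn, huv_ne, huw_ne, hvw_ne]
  obtain ⟨f, hf⟩ := exists_equiv_fin_extending hcard ⟨![u, v, w], hinj⟩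
  exact ⟨f, adjMatrix_le_adjMatrix_gammaOne huv hu hv (hf 0) (hf 1) (hf 2)⟩

end SignedGraph

theorem mainTheorem2 {V : Type*} [Fintype V] (Γ : SignedGraph V) (n : ℕ)
    (hcard : Fintype.card V = n) (hn : 12 ≤ n) (hunbalanced : ¬ Γ.Balanced)
    (hindex : (SignedGraph.gammaOne n).index ≤ Γ.index) :
    Γ.HasNegativeCycle 5 ∨ Γ.SwitchingEquiv (SignedGraph.gammaOne n) := by
  have : Nonempty V := Fintype.card_pos_iff.mp (by omega)
  have : Nonempty (Fin n) := ⟨⟨0, by omega⟩⟩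
  refine or_iff_not_imp_left.mpr fun h5 => ?_
  have hr : (n : ℝ) - 3 < Γ.index :=
    (SignedGraph.sub_three_lt_index_gammaOne (by omega)).trans_le hindex
  have hr9 : 9 ≤ Γ.index := by linarith [show (12 : ℝ) ≤ n by exact_mod_cast hn]
  rw [← hcard] at hr
  obtain ⟨θ, x, hx⟩ := Γ.exists_isNonnegEigenvector_switch
  obtain ⟨u, v, huv⟩ :=
    SignedGraph.exists_adjMatrix_eq_neg_one (mt SignedGraph.Balanced.of_switch hunbalanced)
  have h5_switch : ¬(Γ.switch θ).HasNegativeCycle 5 := mt SignedGraph.HasNegativeCycle.of_switch h5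
  obtain ⟨w, hu, hv⟩ := hx.exists_posNeighborFinset_eq_singleton hr hr9 h5_switch huv
  obtain ⟨f, hle⟩ := SignedGraph.exists_equiv_adjMatrix_le_adjMatrix_gammaOne hcard huv hu hv
  exact ⟨θ, SignedGraph.isomorphic_of_adjMatrix_eq f
    (hx.adjMatrix_eq_submatrix_of_le hr hindex f hle)⟩
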